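/- Let $(M,J,g)$ be a Hermitian manifold ($J$ an integrable complex structure, $g$ a Riemannian metric with $g(J\cdot,J\cdot)=g$; everything is smooth), with fundamental form $\omega(\cdot,\cdot)=g(J\cdot,\cdot)$, and let $\nabla$ be the Levi-Civita connection of $g$. Suppose that $(M,J,g)$ is locally conformally Kähler with Lee form $\theta$, i.e. $\theta$ is a $1$-form with $d\theta=0$ and $d\omega=\theta\wedge\omega$. Let $T=\theta^\sharp$ be the Lee vector field (the $g$-dual of $\theta$), let $F=\nabla T$ be the endomorphism field $X\mapsto\nabla_XT$ of $TM$, and let $J$ act on $1$-forms by $J\alpha=-\alpha\circ J$ (equivalently $(J\alpha)^\sharp=J(\alpha^\sharp)$). If $T$ is holomorphic, i.e. $\mathcal L_TJ=0$, then $$ \begin{aligned} dJd|\theta|^2={}&4\,\omega(F^2\cdot,\cdot)+2\,\omega((\mathcal L_TF)\cdot,\cdot)-T(|\theta|^2)\,\omega-2|\theta|^2\,\omega(F\cdot,\cdot)\\ &+d|\theta|^2\wedge J\theta+\theta\wedge Jd|\theta|^2 , \end{aligned} $$ where $(\alpha\wedge\beta)(X,Y)=\alpha(X)\beta(Y)-\alpha(Y)\beta(X)$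 for $1$-forms $\alpha,\beta$. -/

import Mathlib

open Bundle VectorField
open scoped Manifold ContDiff

noncomputable section

namespace LCK

section Basic

variable {E : Type*} [NormedAddCommGroup E] [NormedSpace ℝ E]
  {M : Type*} [TopologicalSpace M] [ChartedSpace E M]

/-- `X` is a smooth (`C^∞`) vector field. -/
def IsSmoothVF [IsManifold 𝓘(ℝ, E) ∞ M] (X : Π x : M, TangentSpace 𝓘(ℝ, E) x) : Prop :=
  ContMDiff 𝓘(ℝ, E) 𝓘(ℝ, E).tangent ∞ (fun x ↦ (⟨x, X x⟩ : TangentBundle 𝓘(ℝ, E) M))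

/-- `α` is a smooth `1`-form, i.e. a smooth section of the cotangent bundle. -/
def IsSmoothOneForm [IsManifold 𝓘(ℝ, E) ∞ M]
    (α : Π x : M, TangentSpace 𝓘(ℝ, E) x →L[ℝ] ℝ) : Prop :=
  ContMDiff 𝓘(ℝ, E) (𝓘(ℝ, E).prod 𝓘(ℝ, E →L[ℝ] ℝ)) ∞
    (fun x ↦ TotalSpace.mk' (E →L[ℝ] ℝ)
      (E := fun x : M ↦ TangentSpace 𝓘(ℝ, E) x →L[ℝ] ℝ) x (α x))

/-- `A` is a smooth field of endomorphisms of the tangent bundle. -/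
def IsSmoothEnd [IsManifold 𝓘(ℝ, E) ∞ M]
    (A : Π x : M, TangentSpace 𝓘(ℝ, E) x →L[ℝ] TangentSpace 𝓘(ℝ, E) x) : Prop :=
  ContMDiff 𝓘(ℝ, E) (𝓘(ℝ, E).prod 𝓘(ℝ, E →L[ℝ] E)) ∞
    (fun x ↦ TotalSpace.mk' (E →L[ℝ] E)
      (E := fun x : M ↦ TangentSpace 𝓘(ℝ, E) x →L[ℝ] TangentSpace 𝓘(ℝ, E) x) x (A x))

/-- The differential `df` of a real function, a `1`-form. -/
def dZero (f : M → ℝ) (x : M) : TangentSpace 𝓘(ℝ, E) x →L[ℝ] ℝ :=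
  mvfderiv 𝓘(ℝ, E) f x

/-- The derivative `X(f)` of a real function along a vector field. -/
def dirDeriv (X : Π x : M, TangentSpace 𝓘(ℝ, E) x) (f : M → ℝ) (x : M) : ℝ :=
  dZero f x (X x)

/-- The exterior derivative of a `1`-form, evaluated on vector fields:
`dα(X, Y) = X(α(Y)) - Y(α(X)) - α([X, Y])`. -/
def dOne (α : Π x : M, TangentSpace 𝓘(ℝ, E) x →L[ℝ] ℝ)
    (X Y : Π x : M, TangentSpace 𝓘(ℝ, E) x) (x : M) : ℝ :=
  dirDeriv X (fun y ↦ α y (Y y)) x - dirDeriv Y (fun y ↦ α y (X y)) x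
    - α x (mlieBracket 𝓘(ℝ, E) X Y x)

/-- The exterior derivative of a `2`-form, evaluated on vector fields:
`dη(X, Y, Z) = X(η(Y, Z)) + Y(η(Z, X)) + Z(η(X, Y)) - η([X, Y], Z) - η([Y, Z], X) - η([Z, X], Y)`.
-/
def dTwo (η : Π x : M, TangentSpace 𝓘(ℝ, E) x → TangentSpace 𝓘(ℝ, E) x → ℝ)
    (X Y Z : Π x : M, TangentSpace 𝓘(ℝ, E) x) (x : M) : ℝ :=
  dirDeriv X (fun y ↦ η y (Y y) (Z y)) x + dirDeriv Y (fun y ↦ η y (Z y) (X y)) x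
    + dirDeriv Z (fun y ↦ η y (X y) (Y y)) x
    - η x (mlieBracket 𝓘(ℝ, E) X Y x) (Z x) - η x (mlieBracket 𝓘(ℝ, E) Y Z x) (X x)
    - η x (mlieBracket 𝓘(ℝ, E) Z X x) (Y x)

/-- The wedge product of two `1`-forms: `(α ∧ β)(u, v) = α(u) β(v) - α(v) β(u)`. -/
def wedgeOneOne (α β : Π x : M, TangentSpace 𝓘(ℝ, E) x →L[ℝ] ℝ) (x : M)
    (u v : TangentSpace 𝓘(ℝ, E) x) : ℝ :=
  α x u * β x v - α x v * β x u

/-- The wedge product of a `1`-form with a `2`-form: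
`(α ∧ η)(u, v, w) = α(u) η(v, w) + α(v) η(w, u) + α(w) η(u, v)`. -/
def wedgeOneTwo (α : Π x : M, TangentSpace 𝓘(ℝ, E) x →L[ℝ] ℝ)
    (η : Π x : M, TangentSpace 𝓘(ℝ, E) x → TangentSpace 𝓘(ℝ, E) x → ℝ) (x : M)
    (u v w : TangentSpace 𝓘(ℝ, E) x) : ℝ :=
  α x u * η x v w + α x v * η x w u + α x w * η x u v

/-- The Lie derivative of an endomorphism field along `T`, evaluated on a vector field:
`(L_T A)(X) = [T, A X] - A [T, X]`. -/
def lieDerivEnd (T : Π x : M, TangentSpace 𝓘(ℝ, E) x)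
    (A : Π x : M, TangentSpace 𝓘(ℝ, E) x →L[ℝ] TangentSpace 𝓘(ℝ, E) x)
    (X : Π x : M, TangentSpace 𝓘(ℝ, E) x) (x : M) : TangentSpace 𝓘(ℝ, E) x :=
  mlieBracket 𝓘(ℝ, E) T (fun y ↦ A y (X y)) x - A x (mlieBracket 𝓘(ℝ, E) T X x)

/-- The Nijenhuis tensor of `J`, evaluated on vector fields:
`N(X, Y) = [J X, J Y] - J [J X, Y] - J [X, J Y] - [X, Y]`. -/
def nijenhuis (J : Π x : M, TangentSpace 𝓘(ℝ, E) x →L[ℝ] TangentSpace 𝓘(ℝ, E) x)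
    (X Y : Π x : M, TangentSpace 𝓘(ℝ, E) x) (x : M) : TangentSpace 𝓘(ℝ, E) x :=
  mlieBracket 𝓘(ℝ, E) (fun y ↦ J y (X y)) (fun y ↦ J y (Y y)) x
    - J x (mlieBracket 𝓘(ℝ, E) (fun y ↦ J y (X y)) Y x)
    - J x (mlieBracket 𝓘(ℝ, E) X (fun y ↦ J y (Y y)) x)
    - mlieBracket 𝓘(ℝ, E) X Y x

/-- `J` is a complex structure: a smooth almost complex structure which is integrable, i.e. whose
Nijenhuis tensor vanishes. -/
structure IsComplexStructure [IsManifold 𝓘(ℝ, E) ∞ M]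
    (J : Π x : M, TangentSpace 𝓘(ℝ, E) x →L[ℝ] TangentSpace 𝓘(ℝ, E) x) : Prop where
  smooth : IsSmoothEnd J
  sq : ∀ x u, J x (J x u) = -u
  integrable : ∀ X Y : Π x : M, TangentSpace 𝓘(ℝ, E) x, IsSmoothVF X → IsSmoothVF Y →
    ∀ x, nijenhuis J X Y x = 0

/-- The real vector field `T` is holomorphic: `L_T J = 0`. -/
def IsHolomorphicVF [IsManifold 𝓘(ℝ, E) ∞ M]
    (J : Π x : M, TangentSpace 𝓘(ℝ, E) x →L[ℝ] TangentSpace 𝓘(ℝ, E) x)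
    (T : Π x : M, TangentSpace 𝓘(ℝ, E) x) : Prop :=
  IsSmoothVF T ∧ ∀ X : Π x : M, TangentSpace 𝓘(ℝ, E) x, IsSmoothVF X →
    ∀ x, lieDerivEnd T J X x = 0

/-- The action of `J` on `1`-forms, `(J α)(u) = -α(J u)`. With respect to any Hermitian metric this
is the action of `J` on vectors transported by the musical isomorphism: `(J α)♯ = J (α♯)`. -/
def JForm (J : Π x : M, TangentSpace 𝓘(ℝ, E) x →L[ℝ] TangentSpace 𝓘(ℝ, E) x)
    (α : Π x : M, TangentSpace 𝓘(ℝ, E) x →L[ℝ] ℝ) (x : M) : TangentSpace 𝓘(ℝ, E) x →L[ℝ] ℝ :=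
  -(α x ∘L J x)

end Basic

section Metric

variable {E : Type*} [NormedAddCommGroup E] [NormedSpace ℝ E] [FiniteDimensional ℝ E]
  {M : Type*} [TopologicalSpace M] [ChartedSpace E M] [IsManifold 𝓘(ℝ, E) ∞ M]
  [RiemannianBundle (fun x : M ↦ TangentSpace 𝓘(ℝ, E) x)]

instance finiteDimensional_tangentSpace (x : M) :
    FiniteDimensional ℝ (TangentSpace 𝓘(ℝ, E) x) :=
  inferInstanceAs (FiniteDimensional ℝ E)

instance completeSpace_tangentSpace (x : M) : CompleteSpace (TangentSpace 𝓘(ℝ, E) x) :=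
  FiniteDimensional.complete ℝ _

/-- The vector field `α♯` which is dual to the `1`-form `α` with respect to the metric. -/
def sharp (α : Π x : M, TangentSpace 𝓘(ℝ, E) x →L[ℝ] ℝ) (x : M) : TangentSpace 𝓘(ℝ, E) x :=
  (InnerProductSpace.toDual ℝ (TangentSpace 𝓘(ℝ, E) x)).symm (α x)

/-- The function `|α|²`, for the norm on covectors which is dual to the metric. -/
def normSq (α : Π x : M, TangentSpace 𝓘(ℝ, E) x →L[ℝ] ℝ) (x : M) : ℝ :=
  ‖α x‖ ^ 2

/-- The fundamental form `ω(u, v) = g(J u, v)`. -/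
def fundForm (J : Π x : M, TangentSpace 𝓘(ℝ, E) x →L[ℝ] TangentSpace 𝓘(ℝ, E) x) (x : M)
    (u v : TangentSpace 𝓘(ℝ, E) x) : ℝ :=
  inner ℝ (J x u) v

/-- `(M, J, g)` is a Hermitian manifold. -/
structure IsHermitian (J : Π x : M, TangentSpace 𝓘(ℝ, E) x →L[ℝ] TangentSpace 𝓘(ℝ, E) x) :
    Prop where
  complex : IsComplexStructure J
  inner_map_map : ∀ (x : M) (u v : TangentSpace 𝓘(ℝ, E) x),
    inner ℝ (J x u) (J x v) = inner ℝ u v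

/-- `(M, J, g)` is locally conformally Kähler with Lee form `θ`: the manifold is Hermitian, `θ` is
closed and `dω = θ ∧ ω`. -/
structure IsLCK (J : Π x : M, TangentSpace 𝓘(ℝ, E) x →L[ℝ] TangentSpace 𝓘(ℝ, E) x)
    (θ : Π x : M, TangentSpace 𝓘(ℝ, E) x →L[ℝ] ℝ) : Prop where
  hermitian : IsHermitian J
  smooth : IsSmoothOneForm θ
  closed : ∀ X Y : Π x : M, TangentSpace 𝓘(ℝ, E) x, IsSmoothVF X → IsSmoothVF Y →
    ∀ x, dOne θ X Y x = 0
  d_fundForm : ∀ X Y Z : Π x : M, TangentSpace 𝓘(ℝ, E) x,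
    IsSmoothVF X → IsSmoothVF Y → IsSmoothVF Z →
    ∀ x, dTwo (fundForm J) X Y Z x = wedgeOneTwo θ (fundForm J) x (X x) (Y x) (Z x)

/-- Twice `g(∇_X Y, Z)`, as given by the Koszul formula. -/
def koszul (X Y Z : Π x : M, TangentSpace 𝓘(ℝ, E) x) (x : M) : ℝ :=
  dirDeriv X (fun y ↦ inner ℝ (Y y) (Z y)) x + dirDeriv Y (fun y ↦ inner ℝ (X y) (Z y)) x
    - dirDeriv Z (fun y ↦ inner ℝ (X y) (Y y)) x
    + inner ℝ (mlieBracket 𝓘(ℝ, E) X Y x) (Z x) - inner ℝ (mlieBracket 𝓘(ℝ, E) X Z x) (Y x)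
    - inner ℝ (mlieBracket 𝓘(ℝ, E) Y Z x) (X x)

variable [IsContMDiffRiemannianBundle 𝓘(ℝ, E) ∞ E (fun x : M ↦ TangentSpace 𝓘(ℝ, E) x)]

theorem mdifferentiableAt_inner {x : M} {X Y : Π x : M, TangentSpace 𝓘(ℝ, E) x}
    (hX : MDiffAt (T% X) x) (hY : MDiffAt (T% Y) x) :
    MDifferentiableAt 𝓘(ℝ, E) 𝓘(ℝ) (fun y ↦ (inner ℝ (X y) (Y y) : ℝ)) x :=
  MDifferentiableAt.inner_bundle (E := fun x : M ↦ TangentSpace 𝓘(ℝ, E) x) hX hY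

theorem koszul_tensorial_left {x : M} {Y Z : Π x : M, TangentSpace 𝓘(ℝ, E) x}
    (hY : MDiffAt (T% Y) x) (hZ : MDiffAt (T% Z) x) :
    TensorialAt 𝓘(ℝ, E) E (fun X ↦ koszul X Y Z x) x where
  smul {f X} hf hX := by
    simp only [koszul, dirDeriv, dZero, Pi.smul_apply', inner_smul_left, RCLike.conj_to_real,
      mvfderiv_fun_mul hf (mdifferentiableAt_inner hX hZ), mvfderiv_fun_mul hf (mdifferentiableAt_inner hX hY),
      mlieBracket_smul_left hf hX, map_smul, inner_add_left, inner_smul_right]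
    simp
    ring
  add {X X'} hX hX' := by
    simp only [koszul, dirDeriv, dZero, Pi.add_apply, inner_add_left,
      mvfderiv_fun_add (mdifferentiableAt_inner hX hZ) (mdifferentiableAt_inner hX' hZ),
      mvfderiv_fun_add (mdifferentiableAt_inner hX hY) (mdifferentiableAt_inner hX' hY),
      mlieBracket_add_left hX hX', map_add, inner_add_right]
    simp
    ring

theorem koszul_tensorial_right {x : M} {X Y : Π x : M, TangentSpace 𝓘(ℝ, E) x}
    (hX : MDiffAt (T% X) x) (hY : MDiffAt (T% Y) x) :
    TensorialAt 𝓘(ℝ, E) E (fun Z ↦ koszul X Y Z x) x where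
  smul {f Z} hf hZ := by
    simp only [koszul, dirDeriv, dZero, Pi.smul_apply', inner_smul_right,
      mvfderiv_fun_mul hf (mdifferentiableAt_inner hX hZ), mvfderiv_fun_mul hf (mdifferentiableAt_inner hY hZ),
      mlieBracket_smul_right hf hZ, map_smul, inner_add_left, inner_smul_left, RCLike.conj_to_real]
    simp [real_inner_comm]
    ring
  add {Z Z'} hZ hZ' := by
    simp only [koszul, dirDeriv, dZero, Pi.add_apply, inner_add_right,
      mvfderiv_fun_add (mdifferentiableAt_inner hX hZ) (mdifferentiableAt_inner hX hZ'),
      mvfderiv_fun_add (mdifferentiableAt_inner hY hZ) (mdifferentiableAt_inner hY hZ'),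
      mlieBracket_add_right hZ hZ', map_add, inner_add_left]
    simp
    ring

open scoped Classical in
/-- The Levi-Civita connection as a bare function: for `Y` differentiable at `x`, the endomorphism
`u ↦ ∇_u Y` of the tangent space at `x` determined by the Koszul formula. (The value `0` where `Y`
is not differentiable is irrelevant.) -/
def leviCivitaFun (Y : Π x : M, TangentSpace 𝓘(ℝ, E) x) (x : M) :
    TangentSpace 𝓘(ℝ, E) x →L[ℝ] TangentSpace 𝓘(ℝ, E) x :=
  if hY : MDiffAt (T% Y) x then
    (2⁻¹ : ℝ) • LinearMap.toContinuousLinearMap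
      ((InnerProductSpace.toDual ℝ (TangentSpace 𝓘(ℝ, E) x)).symm.toLinearEquiv.toLinearMap ∘ₗ
        (TensorialAt.mkHom₂ (fun X Z ↦ koszul X Y Z x) x
          (fun _ hZ ↦ koszul_tensorial_left hY hZ)
          (fun _ hX ↦ koszul_tensorial_right hX hY)).toLinearMap)
  else 0

/-- The Koszul formula characterizing the Levi-Civita connection. -/
theorem inner_leviCivitaFun {x : M} {X Y Z : Π x : M, TangentSpace 𝓘(ℝ, E) x}
    (hX : MDiffAt (T% X) x) (hY : MDiffAt (T% Y) x) (hZ : MDiffAt (T% Z) x) :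
    inner ℝ (leviCivitaFun Y x (X x)) (Z x) = 2⁻¹ * koszul X Y Z x := by
  rw [leviCivitaFun, dif_pos hY]
  have := TensorialAt.mkHom₂_apply (Φ := fun X Z ↦ koszul X Y Z x)
          (fun _ hZ ↦ koszul_tensorial_left hY hZ)
          (fun _ hX ↦ koszul_tensorial_right hX hY) hX hZ
  simp [inner_smul_left, ← this]

theorem leviCivitaFun_ext {x : M} {Y : Π x : M, TangentSpace 𝓘(ℝ, E) x}
    {A : TangentSpace 𝓘(ℝ, E) x →L[ℝ] TangentSpace 𝓘(ℝ, E) x} (hY : MDiffAt (T% Y) x)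
    (h : ∀ X Z : Π x : M, TangentSpace 𝓘(ℝ, E) x, MDiffAt (T% X) x → MDiffAt (T% Z) x →
      2⁻¹ * koszul X Y Z x = inner ℝ (A (X x)) (Z x)) : leviCivitaFun Y x = A := by
  ext u
  refine ext_inner_right ℝ fun v ↦ ?_
  have hu := FiberBundle.mdifferentiableAt_extend 𝓘(ℝ, E) E u
  have hv := FiberBundle.mdifferentiableAt_extend 𝓘(ℝ, E) E v
  have := h _ _ hu hv
  rw [← inner_leviCivitaFun hu hY hv] at this
  simpa using this

/-- The Levi-Civita connection of the metric. -/
def leviCivita : CovariantDerivative 𝓘(ℝ, E) E (fun x : M ↦ TangentSpace 𝓘(ℝ, E) x) where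
  toFun := leviCivitaFun
  isCovariantDerivativeOnUniv :=
    { add := by
        intro Y Y' x hY hY' _
        refine leviCivitaFun_ext (mdifferentiableAt_add_section hY hY') fun X Z hX hZ ↦ ?_
        rw [add_apply, inner_add_left, inner_leviCivitaFun hX hY hZ,
          inner_leviCivitaFun hX hY' hZ]
        simp only [koszul, dirDeriv, dZero, Pi.add_apply, inner_add_left, inner_add_right,
          mvfderiv_fun_add (mdifferentiableAt_inner hY hZ) (mdifferentiableAt_inner hY' hZ),
          mvfderiv_fun_add (mdifferentiableAt_inner hX hY) (mdifferentiableAt_inner hX hY'),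
          mlieBracket_add_left hY hY', mlieBracket_add_right hY hY', map_add,
          add_apply]
        ring
      leibniz := by
        intro Y f x hY hf _
        refine leviCivitaFun_ext (hf.smul_section hY) fun X Z hX hZ ↦ ?_
        rw [add_apply, inner_add_left, smul_apply,
          real_inner_smul_left, inner_leviCivitaFun hX hY hZ,
          ContinuousLinearMap.smulRight_apply, real_inner_smul_left]
        simp only [koszul, dirDeriv, dZero, Pi.smul_apply', real_inner_smul_left,
          real_inner_smul_right,
          mvfderiv_fun_mul hf (mdifferentiableAt_inner hY hZ),
          mvfderiv_fun_mul hf (mdifferentiableAt_inner hX hY),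
          mlieBracket_smul_left hf hY, mlieBracket_smul_right hf hY, map_smul, inner_add_left]
        simp [real_inner_comm]
        ring }

theorem leviCivita_torsion :
    (leviCivita : CovariantDerivative 𝓘(ℝ, E) E (fun x : M ↦ TangentSpace 𝓘(ℝ, E) x)).torsion
      = 0 := by
  rw [CovariantDerivative.torsion_eq_zero_iff]
  intro X Y x hX hY
  refine ext_inner_right ℝ fun v ↦ ?_
  have hv := FiberBundle.mdifferentiableAt_extend 𝓘(ℝ, E) E v
  have h1 := inner_leviCivitaFun hX hY hv
  have h2 := inner_leviCivitaFun hY hX hv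
  simp only [FiberBundle.extend_apply_self] at h1 h2
  rw [inner_sub_left]
  change inner ℝ (leviCivitaFun Y x (X x)) v - inner ℝ (leviCivitaFun X x (Y x)) v = _
  rw [h1, h2, koszul, koszul, mlieBracket_swap_apply (V := Y) (W := X)]
  simp [real_inner_comm]
  ring

theorem leviCivita_metric {x : M} {X Y Z : Π x : M, TangentSpace 𝓘(ℝ, E) x}
    (hX : MDiffAt (T% X) x) (hY : MDiffAt (T% Y) x) (hZ : MDiffAt (T% Z) x) :
    dirDeriv X (fun y ↦ inner ℝ (Y y) (Z y)) x =
      inner ℝ (leviCivita Y x (X x)) (Z x) + inner ℝ (Y x) (leviCivita Z x (X x)) := by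
  have h1 := inner_leviCivitaFun hX hY hZ
  have h2 := inner_leviCivitaFun hX hZ hY
  change _ = inner ℝ (leviCivitaFun Y x (X x)) (Z x) + inner ℝ (Y x) (leviCivitaFun Z x (X x))
  rw [real_inner_comm _ (Y x), h1, h2, koszul, koszul, mlieBracket_swap_apply (V := Z) (W := Y)]
  simp [real_inner_comm, dirDeriv, dZero]
  ring

end Metric

end LCK

end

/-!
Let `L_T` be the Lie derivative along `T = θ♯` and `F = ∇T`. Since `θ` is closed, Cartan's formula
gives `L_T θ = d(θ(T)) = d|θ|²`, and `L_T J = 0` turns this into `J d|θ|² = L_T (J θ)`. As `L_T`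
commutes with `d`, the left-hand side is `d L_T (J θ) = L_T (d J θ)`.

The form `d J θ` is computed from `J θ = ι_T ω`: closedness of `θ` makes `F` symmetric, so
`L_T g = 2 g(F ·, ·)` and `L_T ω = 2 ω(F ·, ·)`, and Cartan's formula together with `dω = θ ∧ ω`
yields `d J θ = L_T ω - ι_T (θ ∧ ω) = 2 ω(F ·, ·) - |θ|² ω + θ ∧ J θ`. Applying `L_T` to this by
the Leibniz rule proves the theorem.
-/

namespace LCK

section RiemannianBundle

open Matrix

theorem gram_mulVec_repr {V ι : Type*} [NormedAddCommGroup V] [InnerProductSpace ℝ V] [Fintype ι]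
    (b : Module.Basis ι ℝ V) (v : V) :
    gram ℝ b *ᵥ b.repr v = fun i ↦ inner ℝ (b i) v := by
  ext i
  conv_rhs => rw [← b.sum_repr v, inner_sum]
  simp only [mulVec, dotProduct, gram_apply, real_inner_smul_right, mul_comm]

theorem repr_eq_cramer_gram_div_det {V ι : Type*} [NormedAddCommGroup V] [InnerProductSpace ℝ V]
    [Fintype ι] [DecidableEq ι] (b : Module.Basis ι ℝ V) (v : V) (i : ι) :
    b.repr v i = (gram ℝ b).cramer (fun j ↦ inner ℝ (b j) v) i / (gram ℝ b).det := by
  have hdet : (gram ℝ b).det ≠ 0 := det_gram_ne_zero_iff_linearIndependent.2 b.linearIndependent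
  rw [eq_div_iff hdet, ← gram_mulVec_repr, cramer_eq_adjugate_mulVec, mulVec_mulVec, adjugate_mul,
    smul_mulVec, one_mulVec, Pi.smul_apply, smul_eq_mul, mul_comm]

variable {EB : Type*} [NormedAddCommGroup EB] [NormedSpace ℝ EB]
  {HB : Type*} [TopologicalSpace HB] {IB : ModelWithCorners ℝ EB HB} {n : WithTop ℕ∞}
  {B : Type*} [TopologicalSpace B] [ChartedSpace HB B] {x : B}

section Det

variable {ι : Type*} [Fintype ι] [DecidableEq ι] {A : B → Matrix ι ι ℝ}

theorem contMDiffAt_det (hA : ∀ i j, ContMDiffAt IB 𝓘(ℝ) n (fun y ↦ A y i j) x) :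
    ContMDiffAt IB 𝓘(ℝ) n (fun y ↦ (A y).det) x := by
  simp only [det_apply']
  exact contMDiffAt_finsetSum fun σ _ ↦ contMDiffAt_const.mul
    (contMDiffAt_finsetProd fun i _ ↦ hA _ _)

theorem contMDiffAt_cramer {w : B → ι → ℝ}
    (hA : ∀ i j, ContMDiffAt IB 𝓘(ℝ) n (fun y ↦ A y i j) x)
    (hw : ∀ i, ContMDiffAt IB 𝓘(ℝ) n (fun y ↦ w y i) x) (i : ι) :
    ContMDiffAt IB 𝓘(ℝ) n (fun y ↦ (A y).cramer (w y) i) x := by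
  simp only [cramer_apply]
  refine contMDiffAt_det fun k l ↦ ?_
  obtain rfl | hl := eq_or_ne l i
  · simpa only [updateCol_self] using hw k
  · simpa only [updateCol_ne hl] using hA k l

end Det

variable {F : Type*} [NormedAddCommGroup F] [NormedSpace ℝ F] [FiniteDimensional ℝ F]
  {V : B → Type*} [TopologicalSpace (TotalSpace F V)] [∀ x, NormedAddCommGroup (V x)]
  [∀ x, InnerProductSpace ℝ (V x)] [FiberBundle F V] [VectorBundle ℝ F V]
  [IsContMDiffRiemannianBundle IB n F V]

/-- By Cramer's rule the coefficients of `σ` are rational in the inner products. -/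
theorem contMDiffAt_of_inner_localFrame {ι : Type*} {s : ι → Π y, V y} {u : Set B}
    {σ : Π y, V y} (hs : IsLocalFrameOn IB F n s u) (hu : u ∈ nhds x)
    (hσ : ∀ i, ContMDiffAt IB 𝓘(ℝ) n (fun y ↦ (inner ℝ (s i y) (σ y) : ℝ)) x) :
    ContMDiffAt IB (IB.prod 𝓘(ℝ, F)) n (fun y ↦ TotalSpace.mk' F y (σ y)) x := by
  classical
  have := hs.fintypeOfFiniteDimensional (mem_of_mem_nhds hu)
  have hs' (i : ι) : ContMDiffAt IB (IB.prod 𝓘(ℝ, F)) n (fun y ↦ TotalSpace.mk' F y (s i y)) x :=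
    (hs.contMDiffOn i).contMDiffAt hu
  have hgram (i j : ι) : ContMDiffAt IB 𝓘(ℝ) n (fun y ↦ gram ℝ (s · y) i j) x :=
    (hs' i).inner_bundle (hs' j)
  have hdet : (gram ℝ (s · x)).det ≠ 0 :=
    det_gram_ne_zero_iff_linearIndependent.2 (hs.linearIndependent (mem_of_mem_nhds hu))
  refine hs.contMDiffAt_of_coeff (fun i ↦ ?_) hu
  refine ((contMDiffAt_cramer hgram hσ i).div₀ (contMDiffAt_det hgram) hdet).congr_of_eventuallyEq
    (Filter.eventually_of_mem hu fun y hy ↦ ?_)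
  have hbasis : ⇑(hs.toBasisAt hy) = (s · y) := funext (hs.toBasisAt_coe hy)
  have hrepr := repr_eq_cramer_gram_div_det (hs.toBasisAt hy) (σ y) i
  rw [hbasis] at hrepr
  exact (hs.coeff_apply_of_mem hy σ i).trans hrepr

end RiemannianBundle

section LieDerivative

variable {E : Type*} [NormedAddCommGroup E] [NormedSpace ℝ E]
  {M : Type*} [TopologicalSpace M] [ChartedSpace E M]
  {T X Y : Π x : M, TangentSpace 𝓘(ℝ, E) x} {f g : M → ℝ} {x : M}

theorem dirDeriv_add (X : Π x : M, TangentSpace 𝓘(ℝ, E) x)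
    (hf : MDifferentiableAt 𝓘(ℝ, E) 𝓘(ℝ) f x) (hg : MDifferentiableAt 𝓘(ℝ, E) 𝓘(ℝ) g x) :
    dirDeriv X (fun y ↦ f y + g y) x = dirDeriv X f x + dirDeriv X g x := by
  simp only [dirDeriv, dZero, mvfderiv_fun_add hf hg, add_apply]

theorem dirDeriv_sub (X : Π x : M, TangentSpace 𝓘(ℝ, E) x)
    (hf : MDifferentiableAt 𝓘(ℝ, E) 𝓘(ℝ) f x) (hg : MDifferentiableAt 𝓘(ℝ, E) 𝓘(ℝ) g x) :
    dirDeriv X (fun y ↦ f y - g y) x = dirDeriv X f x - dirDeriv X g x := by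
  simp only [dirDeriv, dZero, mvfderiv_fun_sub hf hg, sub_apply]

theorem dirDeriv_mul (X : Π x : M, TangentSpace 𝓘(ℝ, E) x)
    (hf : MDifferentiableAt 𝓘(ℝ, E) 𝓘(ℝ) f x) (hg : MDifferentiableAt 𝓘(ℝ, E) 𝓘(ℝ) g x) :
    dirDeriv X (fun y ↦ f y * g y) x = f x * dirDeriv X g x + g x * dirDeriv X f x := by
  simp only [dirDeriv, dZero, mvfderiv_fun_mul hf hg, add_apply, smul_apply, smul_eq_mul]

theorem dirDeriv_neg (X : Π x : M, TangentSpace 𝓘(ℝ, E) x) (f : M → ℝ) (x : M) :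
    dirDeriv X (fun y ↦ -f y) x = -dirDeriv X f x := by
  simp only [dirDeriv, dZero, mvfderiv_fun_neg, neg_apply]

theorem dirDeriv_const (X : Π x : M, TangentSpace 𝓘(ℝ, E) x) (c : ℝ) (x : M) :
    dirDeriv X (fun _ ↦ c) x = 0 := by
  simp only [dirDeriv, dZero, mvfderiv_const, zero_apply]

/-- The Lie derivative of a `1`-form along `T`, evaluated on a vector field:
`(L_T α)(X) = T(α(X)) - α([T, X])`. -/
noncomputable def lieDerivOne (T : Π x : M, TangentSpace 𝓘(ℝ, E) x)
    (α : Π x : M, TangentSpace 𝓘(ℝ, E) x →L[ℝ] ℝ)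
    (X : Π x : M, TangentSpace 𝓘(ℝ, E) x) (x : M) : ℝ :=
  dirDeriv T (fun y ↦ α y (X y)) x - α x (mlieBracket 𝓘(ℝ, E) T X x)

/-- The Lie derivative of a covariant `2`-tensor along `T`, evaluated on vector fields:
`(L_T η)(X, Y) = T(η(X, Y)) - η([T, X], Y) - η(X, [T, Y])`. As in `dTwo`, the tensor is given by its
values on pairs of tangent vectors. -/
noncomputable def lieDerivTwo (T : Π x : M, TangentSpace 𝓘(ℝ, E) x)
    (η : Π x : M, TangentSpace 𝓘(ℝ, E) x → TangentSpace 𝓘(ℝ, E) x → ℝ)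
    (X Y : Π x : M, TangentSpace 𝓘(ℝ, E) x) (x : M) : ℝ :=
  dirDeriv T (fun y ↦ η y (X y) (Y y)) x - η x (mlieBracket 𝓘(ℝ, E) T X x) (Y x)
    - η x (X x) (mlieBracket 𝓘(ℝ, E) T Y x)

section TwoTensor

variable {η ζ : Π x : M, TangentSpace 𝓘(ℝ, E) x → TangentSpace 𝓘(ℝ, E) x → ℝ}

theorem lieDerivTwo_add (T : Π x : M, TangentSpace 𝓘(ℝ, E) x)
    (hη : MDifferentiableAt 𝓘(ℝ, E) 𝓘(ℝ) (fun y ↦ η y (X y) (Y y)) x)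
    (hζ : MDifferentiableAt 𝓘(ℝ, E) 𝓘(ℝ) (fun y ↦ ζ y (X y) (Y y)) x) :
    lieDerivTwo T (fun y u v ↦ η y u v + ζ y u v) X Y x =
      lieDerivTwo T η X Y x + lieDerivTwo T ζ X Y x := by
  simp only [lieDerivTwo, dirDeriv_add T hη hζ]
  ring

theorem lieDerivTwo_sub (T : Π x : M, TangentSpace 𝓘(ℝ, E) x)
    (hη : MDifferentiableAt 𝓘(ℝ, E) 𝓘(ℝ) (fun y ↦ η y (X y) (Y y)) x)
    (hζ : MDifferentiableAt 𝓘(ℝ, E) 𝓘(ℝ) (fun y ↦ ζ y (X y) (Y y)) x) :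
    lieDerivTwo T (fun y u v ↦ η y u v - ζ y u v) X Y x =
      lieDerivTwo T η X Y x - lieDerivTwo T ζ X Y x := by
  simp only [lieDerivTwo, dirDeriv_sub T hη hζ]
  ring

theorem lieDerivTwo_mul (T : Π x : M, TangentSpace 𝓘(ℝ, E) x)
    (hf : MDifferentiableAt 𝓘(ℝ, E) 𝓘(ℝ) f x)
    (hη : MDifferentiableAt 𝓘(ℝ, E) 𝓘(ℝ) (fun y ↦ η y (X y) (Y y)) x) :
    lieDerivTwo T (fun y u v ↦ f y * η y u v) X Y x =
      dirDeriv T f x * η x (X x) (Y x) + f x * lieDerivTwo T η X Y x := by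
  simp only [lieDerivTwo, dirDeriv_mul T hf hη]
  ring

theorem lieDerivTwo_const_mul (T : Π x : M, TangentSpace 𝓘(ℝ, E) x) (c : ℝ)
    (hη : MDifferentiableAt 𝓘(ℝ, E) 𝓘(ℝ) (fun y ↦ η y (X y) (Y y)) x) :
    lieDerivTwo T (fun y u v ↦ c * η y u v) X Y x = c * lieDerivTwo T η X Y x := by
  rw [lieDerivTwo_mul T mdifferentiableAt_const hη, dirDeriv_const, zero_mul, zero_add]

theorem lieDerivTwo_wedgeOneOne {α β : Π x : M, TangentSpace 𝓘(ℝ, E) x →L[ℝ] ℝ}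
    (T : Π x : M, TangentSpace 𝓘(ℝ, E) x)
    (hαX : MDifferentiableAt 𝓘(ℝ, E) 𝓘(ℝ) (fun y ↦ α y (X y)) x)
    (hαY : MDifferentiableAt 𝓘(ℝ, E) 𝓘(ℝ) (fun y ↦ α y (Y y)) x)
    (hβX : MDifferentiableAt 𝓘(ℝ, E) 𝓘(ℝ) (fun y ↦ β y (X y)) x)
    (hβY : MDifferentiableAt 𝓘(ℝ, E) 𝓘(ℝ) (fun y ↦ β y (Y y)) x) :
    lieDerivTwo T (wedgeOneOne α β) X Y x =
      (lieDerivOne T α X x * β x (Y x) - lieDerivOne T α Y x * β x (X x))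
        + (α x (X x) * lieDerivOne T β Y x - α x (Y x) * lieDerivOne T β X x) := by
  have hXY : MDifferentiableAt 𝓘(ℝ, E) 𝓘(ℝ) (fun y ↦ α y (X y) * β y (Y y)) x := hαX.mul hβY
  have hYX : MDifferentiableAt 𝓘(ℝ, E) 𝓘(ℝ) (fun y ↦ α y (Y y) * β y (X y)) x := hαY.mul hβX
  simp only [lieDerivTwo, lieDerivOne, wedgeOneOne, dirDeriv_sub T hXY hYX,
    dirDeriv_mul T hαX hβY, dirDeriv_mul T hαY hβX]
  ring

theorem lieDerivTwo_swap (hη : ∀ y u v, η y u v = -η y v u) :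
    lieDerivTwo T η X Y x = -lieDerivTwo T η Y X x := by
  simp only [lieDerivTwo, funext fun y ↦ hη y (X y) (Y y), dirDeriv_neg, hη x _ (Y x),
    hη x (X x)]
  ring

theorem lieDerivTwo_comp (hη : ∀ u v w, η x (u - v) w = η x u w - η x v w)
    (T : Π x : M, TangentSpace 𝓘(ℝ, E) x)
    (A : Π x : M, TangentSpace 𝓘(ℝ, E) x →L[ℝ] TangentSpace 𝓘(ℝ, E) x)
    (X Y : Π x : M, TangentSpace 𝓘(ℝ, E) x) :
    lieDerivTwo T (fun y u v ↦ η y (A y u) v) X Y x =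
      lieDerivTwo T η (fun y ↦ A y (X y)) Y x + η x (lieDerivEnd T A X x) (Y x) := by
  simp only [lieDerivTwo, lieDerivEnd, hη]
  ring

theorem lieDerivTwo_eq_dTwo_add_dOne {α : Π x : M, TangentSpace 𝓘(ℝ, E) x →L[ℝ] ℝ}
    (hswap : ∀ y u v, η y u v = -η y v u) (hneg : ∀ u v, η x (-u) v = -η x u v)
    (hα : ∀ y u, α y u = η y (T y) u) (X Y : Π x : M, TangentSpace 𝓘(ℝ, E) x) :
    lieDerivTwo T η X Y x = dTwo η T X Y x + dOne α X Y x := by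
  simp only [lieDerivTwo, dTwo, dOne, hα, hswap _ (Y _) (T _), dirDeriv_neg,
    mlieBracket_swap_apply (V := Y) (W := T), hswap x (mlieBracket 𝓘(ℝ, E) X Y x), hneg,
    hswap x (mlieBracket 𝓘(ℝ, E) T Y x)]
  ring

end TwoTensor

theorem lieDerivOne_JForm {J : Π x : M, TangentSpace 𝓘(ℝ, E) x →L[ℝ] TangentSpace 𝓘(ℝ, E) x}
    (α : Π x : M, TangentSpace 𝓘(ℝ, E) x →L[ℝ] ℝ) (hJ : lieDerivEnd T J X x = 0) :
    lieDerivOne T (JForm J α) X x = -lieDerivOne T α (fun y ↦ J y (X y)) x := by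
  have hbracket : mlieBracket 𝓘(ℝ, E) T (fun y ↦ J y (X y)) x =
      J x (mlieBracket 𝓘(ℝ, E) T X x) := sub_eq_zero.1 hJ
  simp only [lieDerivOne, JForm, neg_apply, ContinuousLinearMap.comp_apply, dirDeriv_neg, hbracket]
  ring

theorem lieDerivOne_eq_dOne_add_dZero (T : Π x : M, TangentSpace 𝓘(ℝ, E) x)
    (α : Π x : M, TangentSpace 𝓘(ℝ, E) x →L[ℝ] ℝ)
    (X : Π x : M, TangentSpace 𝓘(ℝ, E) x) (x : M) :
    lieDerivOne T α X x = dOne α T X x + dZero (fun y ↦ α y (T y)) x (X x) := by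
  simp only [lieDerivOne, dOne, dirDeriv]
  ring

end LieDerivative

section Smooth

variable {E : Type*} [NormedAddCommGroup E] [NormedSpace ℝ E]
  {M : Type*} [TopologicalSpace M] [ChartedSpace E M] [IsManifold 𝓘(ℝ, E) ∞ M]
  {U V W X Y Z : Π x : M, TangentSpace 𝓘(ℝ, E) x} {f : M → ℝ} {x : M}

theorem contMDiffAt_dirDeriv (hX : CMDiffAt ∞ (T% X) x)
    (hf : ContMDiffAt 𝓘(ℝ, E) 𝓘(ℝ) ∞ f x) :
    ContMDiffAt 𝓘(ℝ, E) 𝓘(ℝ) ∞ (dirDeriv X f) x := by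
  have hdf := hf.mfderiv_const (m := ∞) (by simp)
  have h := ContMDiffAt.clm_apply_of_inCoordinates (n := ∞) (b₁ := fun y : M ↦ y) (b₂ := f)
    (v := X) (ϕ := fun y ↦ mfderiv 𝓘(ℝ, E) 𝓘(ℝ) f y) hdf hX hf
  have hsnd := (contMDiffAt_totalSpace.1 h).2
  simp only [trivializationAt_model_space_apply] at hsnd
  exact hsnd

theorem IsSmoothVF.contMDiff_dirDeriv (hX : IsSmoothVF X) (hf : ContMDiff 𝓘(ℝ, E) 𝓘(ℝ) ∞ f) :
    ContMDiff 𝓘(ℝ, E) 𝓘(ℝ) ∞ (dirDeriv X f) :=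
  fun x ↦ contMDiffAt_dirDeriv (hX x) (hf x)

theorem IsSmoothVF.mdifferentiableAt (hX : IsSmoothVF X) (x : M) : MDiffAt (T% X) x :=
  (hX x).mdifferentiableAt (by simp)

theorem IsSmoothEnd.apply {A : Π x : M, TangentSpace 𝓘(ℝ, E) x →L[ℝ] TangentSpace 𝓘(ℝ, E) x}
    (hA : IsSmoothEnd A) (hX : IsSmoothVF X) : IsSmoothVF (fun y ↦ A y (X y)) :=
  ContMDiff.clm_bundle_apply (E₁ := fun x : M ↦ TangentSpace 𝓘(ℝ, E) x)
    (E₂ := fun x : M ↦ TangentSpace 𝓘(ℝ, E) x) hA hX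

theorem eventually_mdifferentiableAt_vectorField (hX : CMDiffAt ∞ (T% X) x) :
    ∀ᶠ y in nhds x, MDiffAt (T% X) y :=
  ((contMDiffAt_iff_contMDiffAt_nhds (n := 1) (by simp)).1 (hX.of_le (by simp))).mono
    fun _ hy ↦ hy.mdifferentiableAt one_ne_zero

theorem eventually_mdifferentiableAt (hf : ContMDiffAt 𝓘(ℝ, E) 𝓘(ℝ) ∞ f x) :
    ∀ᶠ y in nhds x, MDifferentiableAt 𝓘(ℝ, E) 𝓘(ℝ) f y :=
  ((contMDiffAt_iff_contMDiffAt_nhds (n := 1) (by simp)).1 (hf.of_le (by simp))).mono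
    fun _ hy ↦ hy.mdifferentiableAt one_ne_zero

variable [CompleteSpace E]

theorem contMDiffAt_mlieBracket (hX : CMDiffAt ∞ (T% X) x) (hY : CMDiffAt ∞ (T% Y) x) :
    CMDiffAt ∞ (T% (mlieBracket 𝓘(ℝ, E) X Y)) x := by
  have : IsManifold 𝓘(ℝ, E) (((⊤ : ℕ∞) : WithTop ℕ∞) + 1) M := ‹IsManifold 𝓘(ℝ, E) ∞ M›
  have : IsManifold 𝓘(ℝ, E) (minSmoothness ℝ 2) M := by
    rw [minSmoothness_of_isRCLikeNormedField]; infer_instance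
  exact ContMDiffAt.mlieBracket_vectorField (m := ⊤) (n := ⊤) hX hY (by simp)

theorem IsSmoothVF.mlieBracket (hX : IsSmoothVF X) (hY : IsSmoothVF Y) :
    IsSmoothVF (mlieBracket 𝓘(ℝ, E) X Y) :=
  fun x ↦ contMDiffAt_mlieBracket (hX x) (hY x)

theorem mlieBracket_jacobi
    (hU : CMDiffAt ∞ (T% U) x) (hV : CMDiffAt ∞ (T% V) x) (hW : CMDiffAt ∞ (T% W) x) :
    mlieBracket 𝓘(ℝ, E) U (mlieBracket 𝓘(ℝ, E) V W) x =
      mlieBracket 𝓘(ℝ, E) (mlieBracket 𝓘(ℝ, E) U V) W x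
        + mlieBracket 𝓘(ℝ, E) V (mlieBracket 𝓘(ℝ, E) U W) x := by
  have : IsManifold 𝓘(ℝ, E) (minSmoothness ℝ 3) M := by
    rw [minSmoothness_of_isRCLikeNormedField]; infer_instance
  have h2 : minSmoothness ℝ 2 ≤ ∞ := by
    rw [minSmoothness_of_isRCLikeNormedField]; exact ENat.LEInfty.out
  exact leibniz_identity_mlieBracket_apply (hU.of_le h2) (hV.of_le h2) (hW.of_le h2)

theorem mlieBracket_mlieBracket_smul (hV : CMDiffAt ∞ (T% V) x)
    (hf : ContMDiffAt 𝓘(ℝ, E) 𝓘(ℝ) ∞ f x) (hZ : CMDiffAt ∞ (T% Z) x) :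
    mlieBracket 𝓘(ℝ, E) U (mlieBracket 𝓘(ℝ, E) V (f • Z)) x =
      dirDeriv U (dirDeriv V f) x • Z x + dirDeriv V f x • mlieBracket 𝓘(ℝ, E) U Z x
        + (dirDeriv U f x • mlieBracket 𝓘(ℝ, E) V Z x
          + f x • mlieBracket 𝓘(ℝ, E) U (mlieBracket 𝓘(ℝ, E) V Z) x) := by
  have hZ' := hZ.mdifferentiableAt (by simp)
  have hf' := hf.mdifferentiableAt (by simp)
  have hVf := (contMDiffAt_dirDeriv hV hf).mdifferentiableAt (by simp)
  have hVZ := (contMDiffAt_mlieBracket hV hZ).mdifferentiableAt (by simp)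
  have hinner : mlieBracket 𝓘(ℝ, E) V (f • Z) =ᶠ[nhds x]
      dirDeriv V f • Z + f • mlieBracket 𝓘(ℝ, E) V Z := by
    filter_upwards [eventually_mdifferentiableAt hf, eventually_mdifferentiableAt_vectorField hZ]
      with y hfy hZy using mlieBracket_smul_right hfy hZy
  rw [Filter.EventuallyEq.mlieBracket_vectorField_eq (.refl _ U) hinner,
    mlieBracket_add_right (hVf.smul_section hZ') (hf'.smul_section hVZ),
    mlieBracket_smul_right hVf hZ', mlieBracket_smul_right hf' hVZ]
  rfl

/-- The Jacobi identity for `U`, `V` and `f • Z` exhibits both sides as the coefficient of `Z`. -/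
theorem dirDeriv_mlieBracket (hU : CMDiffAt ∞ (T% U) x) (hV : CMDiffAt ∞ (T% V) x)
    (hf : ContMDiffAt 𝓘(ℝ, E) 𝓘(ℝ) ∞ f x) :
    dirDeriv (mlieBracket 𝓘(ℝ, E) U V) f x =
      dirDeriv U (dirDeriv V f) x - dirDeriv V (dirDeriv U f) x := by
  cases subsingleton_or_nontrivial (TangentSpace 𝓘(ℝ, E) x) with
  | inl _ => simp [dirDeriv, Subsingleton.elim _ (0 : TangentSpace 𝓘(ℝ, E) x)]
  | inr _ =>
    obtain ⟨v, hv⟩ := exists_ne (0 : TangentSpace 𝓘(ℝ, E) x)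
    let Z : Π y : M, TangentSpace 𝓘(ℝ, E) y := FiberBundle.extend E v
    have hZx : Z x = v := FiberBundle.extend_apply_self _ _
    have hZ : CMDiffAt ∞ (T% Z) x := FiberBundle.contMDiffAt_extend 𝓘(ℝ, E) E v
    have jacobi_smul := mlieBracket_jacobi hU hV (hf.smul_section hZ)
    have bracket_smul : mlieBracket 𝓘(ℝ, E) (mlieBracket 𝓘(ℝ, E) U V) (f • Z) x =
        dirDeriv (mlieBracket 𝓘(ℝ, E) U V) f x • Z x
          + f x • mlieBracket 𝓘(ℝ, E) (mlieBracket 𝓘(ℝ, E) U V) Z x :=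
      mlieBracket_smul_right (hf.mdifferentiableAt (by simp)) (hZ.mdifferentiableAt (by simp))
    rw [mlieBracket_mlieBracket_smul hV hf hZ, mlieBracket_mlieBracket_smul hU hf hZ,
      bracket_smul, mlieBracket_jacobi hU hV hZ, hZx] at jacobi_smul
    refine smul_left_injective ℝ hv ?_
    simp only [sub_smul]
    linear_combination (norm := module) (-1 : ℝ) • jacobi_smul

theorem dirDeriv_dOne {α : Π x : M, TangentSpace 𝓘(ℝ, E) x →L[ℝ] ℝ}
    (hα : ∀ Z : Π x : M, TangentSpace 𝓘(ℝ, E) x, IsSmoothVF Z →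
      ContMDiff 𝓘(ℝ, E) 𝓘(ℝ) ∞ (fun y ↦ α y (Z y)))
    (T : Π x : M, TangentSpace 𝓘(ℝ, E) x) (hX : IsSmoothVF X) (hY : IsSmoothVF Y) (x : M) :
    dirDeriv T (dOne α X Y) x = dirDeriv T (dirDeriv X fun y ↦ α y (Y y)) x
      - dirDeriv T (dirDeriv Y fun y ↦ α y (X y)) x
      - dirDeriv T (fun y ↦ α y (mlieBracket 𝓘(ℝ, E) X Y y)) x := by
  have hXY := (hX.contMDiff_dirDeriv (hα Y hY)).mdifferentiable (by simp) x
  have hYX := (hY.contMDiff_dirDeriv (hα X hX)).mdifferentiable (by simp) x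
  have hsub : MDifferentiableAt 𝓘(ℝ, E) 𝓘(ℝ) (fun y ↦ dirDeriv X (fun z ↦ α z (Y z)) y
      - dirDeriv Y (fun z ↦ α z (X z)) y) x := hXY.sub hYX
  have hbracket := (hα _ (hX.mlieBracket hY)).mdifferentiable (by simp) x
  rw [← dirDeriv_sub T hXY hYX, ← dirDeriv_sub T hsub hbracket]
  rfl

theorem dOne_lieDerivOne {T : Π x : M, TangentSpace 𝓘(ℝ, E) x}
    {α β : Π x : M, TangentSpace 𝓘(ℝ, E) x →L[ℝ] ℝ}
    {η : Π x : M, TangentSpace 𝓘(ℝ, E) x → TangentSpace 𝓘(ℝ, E) x → ℝ}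
    (hα : ∀ Z : Π x : M, TangentSpace 𝓘(ℝ, E) x, IsSmoothVF Z →
      ContMDiff 𝓘(ℝ, E) 𝓘(ℝ) ∞ (fun y ↦ α y (Z y)))
    (hβ : ∀ Z : Π x : M, TangentSpace 𝓘(ℝ, E) x, IsSmoothVF Z →
      ∀ y, β y (Z y) = lieDerivOne T α Z y)
    (hη : ∀ Z W : Π x : M, TangentSpace 𝓘(ℝ, E) x, IsSmoothVF Z → IsSmoothVF W →
      ∀ y, dOne α Z W y = η y (Z y) (W y))
    (hT : IsSmoothVF T) (hX : IsSmoothVF X) (hY : IsSmoothVF Y) (x : M) :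
    dOne β X Y x = lieDerivTwo T η X Y x := by
  have hmd {Z : Π x : M, TangentSpace 𝓘(ℝ, E) x} (hZ : IsSmoothVF Z) :=
    (hα Z hZ).mdifferentiable (by simp) x
  have hmdT {Z : Π x : M, TangentSpace 𝓘(ℝ, E) x} (hZ : IsSmoothVF Z) :=
    (hT.contMDiff_dirDeriv (hα Z hZ)).mdifferentiable (by simp) x
  have hTX := hT.mlieBracket hX
  have hTY := hT.mlieBracket hY
  rw [lieDerivTwo, ← funext (hη X Y hX hY), ← hη _ _ hTX hY, ← hη _ _ hX hTY,
    dirDeriv_dOne hα T hX hY]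
  simp only [dOne, hβ X hX, hβ Y hY, hβ _ (hX.mlieBracket hY), lieDerivOne,
    dirDeriv_sub X (hmdT hY) (hmd hTY), dirDeriv_sub Y (hmdT hX) (hmd hTX),
    mlieBracket_jacobi (hT x) (hX x) (hY x), map_add,
    dirDeriv_mlieBracket (hT x) (hX x) (hα Y hY x), dirDeriv_mlieBracket (hT x) (hY x) (hα X hX x)]
  ring

end Smooth

section Metric

variable {E : Type*} [NormedAddCommGroup E] [NormedSpace ℝ E]
  {M : Type*} [TopologicalSpace M] [ChartedSpace E M] [IsManifold 𝓘(ℝ, E) ∞ M]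
  [RiemannianBundle (fun x : M ↦ TangentSpace 𝓘(ℝ, E) x)]
  [IsContMDiffRiemannianBundle 𝓘(ℝ, E) ∞ E (fun x : M ↦ TangentSpace 𝓘(ℝ, E) x)]
  {T X Y Z : Π x : M, TangentSpace 𝓘(ℝ, E) x} {x : M}

theorem contMDiffAt_inner (hX : CMDiffAt ∞ (T% X) x) (hY : CMDiffAt ∞ (T% Y) x) :
    ContMDiffAt 𝓘(ℝ, E) 𝓘(ℝ) ∞ (fun y ↦ (inner ℝ (X y) (Y y) : ℝ)) x :=
  ContMDiffAt.inner_bundle (E := fun x : M ↦ TangentSpace 𝓘(ℝ, E) x) hX hY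

theorem IsSmoothVF.inner (hX : IsSmoothVF X) (hY : IsSmoothVF Y) :
    ContMDiff 𝓘(ℝ, E) 𝓘(ℝ) ∞ (fun y ↦ (inner ℝ (X y) (Y y) : ℝ)) :=
  fun x ↦ contMDiffAt_inner (hX x) (hY x)

theorem IsSmoothEnd.contMDiff_fundForm
    {J : Π x : M, TangentSpace 𝓘(ℝ, E) x →L[ℝ] TangentSpace 𝓘(ℝ, E) x} (hJ : IsSmoothEnd J)
    (hX : IsSmoothVF X) (hY : IsSmoothVF Y) :
    ContMDiff 𝓘(ℝ, E) 𝓘(ℝ) ∞ (fun y ↦ fundForm J y (X y) (Y y)) :=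
  (hJ.apply hX).inner hY

theorem contMDiffAt_koszul [CompleteSpace E] (hX : CMDiffAt ∞ (T% X) x)
    (hY : CMDiffAt ∞ (T% Y) x) (hZ : CMDiffAt ∞ (T% Z) x) :
    ContMDiffAt 𝓘(ℝ, E) 𝓘(ℝ) ∞ (koszul X Y Z) x :=
  (((((contMDiffAt_dirDeriv hX (contMDiffAt_inner hY hZ)).add
    (contMDiffAt_dirDeriv hY (contMDiffAt_inner hX hZ))).sub
    (contMDiffAt_dirDeriv hZ (contMDiffAt_inner hX hY))).add
    (contMDiffAt_inner (contMDiffAt_mlieBracket hX hY) hZ)).sub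
    (contMDiffAt_inner (contMDiffAt_mlieBracket hX hZ) hY)).sub
    (contMDiffAt_inner (contMDiffAt_mlieBracket hY hZ) hX)

variable [FiniteDimensional ℝ E]

theorem contMDiffAt_inner_leviCivita (hX : CMDiffAt ∞ (T% X) x) (hY : CMDiffAt ∞ (T% Y) x)
    (hZ : CMDiffAt ∞ (T% Z) x) :
    ContMDiffAt 𝓘(ℝ, E) 𝓘(ℝ) ∞ (fun y ↦ (inner ℝ (Z y) (leviCivita Y y (X y)) : ℝ)) x := by
  have : CompleteSpace E := FiniteDimensional.complete ℝ E
  refine (contMDiffAt_const.mul (contMDiffAt_koszul hX hY hZ)).congr_of_eventuallyEq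
    (f₁ := fun y ↦ (inner ℝ (Z y) (leviCivita Y y (X y)) : ℝ))
    (f := fun y ↦ 2⁻¹ * koszul X Y Z y) ?_
  filter_upwards [eventually_mdifferentiableAt_vectorField hX,
    eventually_mdifferentiableAt_vectorField hY, eventually_mdifferentiableAt_vectorField hZ]
    with y hXy hYy hZy
  rw [real_inner_comm]
  exact inner_leviCivitaFun hXy hYy hZy

theorem IsSmoothVF.leviCivita (hX : IsSmoothVF X) (hY : IsSmoothVF Y) :
    IsSmoothVF (fun y ↦ leviCivita Y y (X y)) := by
  intro x
  let e := trivializationAt E (fun x : M ↦ TangentSpace 𝓘(ℝ, E) x) x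
  have hx : x ∈ e.baseSet := FiberBundle.mem_baseSet_trivializationAt' x
  have hs := e.isLocalFrameOn_localFrame_baseSet 𝓘(ℝ, E) ∞ (Module.finBasis ℝ E)
  exact contMDiffAt_of_inner_localFrame (V := fun x : M ↦ TangentSpace 𝓘(ℝ, E) x) hs
    (e.open_baseSet.mem_nhds hx) fun i ↦ contMDiffAt_inner_leviCivita (hX x) (hY x)
      (hs.contMDiffAt e.open_baseSet hx i)

theorem leviCivita_sub_leviCivita (hX : MDiffAt (T% X) x) (hY : MDiffAt (T% Y) x) :
    leviCivita Y x (X x) - leviCivita X x (Y x) = mlieBracket 𝓘(ℝ, E) X Y x :=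
  (CovariantDerivative.torsion_eq_zero_iff _).1 leviCivita_torsion hX hY

theorem lieDerivTwo_inner (hT : MDiffAt (T% T) x) (hX : MDiffAt (T% X) x)
    (hY : MDiffAt (T% Y) x) :
    lieDerivTwo T (fun _ u v ↦ inner ℝ u v) X Y x =
      inner ℝ (leviCivita T x (X x)) (Y x) + inner ℝ (X x) (leviCivita T x (Y x)) := by
  rw [lieDerivTwo, leviCivita_metric hT hX hY, ← leviCivita_sub_leviCivita hT hX,
    ← leviCivita_sub_leviCivita hT hY, inner_sub_left, inner_sub_right]
  ring

end Metric

section Sharp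

variable {E : Type*} [NormedAddCommGroup E] [NormedSpace ℝ E] [FiniteDimensional ℝ E]
  {M : Type*} [TopologicalSpace M] [ChartedSpace E M]
  [RiemannianBundle (fun x : M ↦ TangentSpace 𝓘(ℝ, E) x)]

theorem inner_sharp_left (θ : Π x : M, TangentSpace 𝓘(ℝ, E) x →L[ℝ] ℝ) (x : M)
    (u : TangentSpace 𝓘(ℝ, E) x) : inner ℝ (sharp θ x) u = θ x u :=
  InnerProductSpace.toDual_symm_apply

theorem normSq_eq_apply_sharp (θ : Π x : M, TangentSpace 𝓘(ℝ, E) x →L[ℝ] ℝ) :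
    normSq θ = fun x ↦ θ x (sharp θ x) := by
  ext x
  rw [← inner_sharp_left, real_inner_self_eq_norm_sq, normSq, sharp, LinearIsometryEquiv.norm_map]

end Sharp

section SkewAdjoint

variable {E : Type*} [NormedAddCommGroup E] [NormedSpace ℝ E]
  {M : Type*} [TopologicalSpace M] [ChartedSpace E M]
  [RiemannianBundle (fun x : M ↦ TangentSpace 𝓘(ℝ, E) x)]
  {J : Π x : M, TangentSpace 𝓘(ℝ, E) x →L[ℝ] TangentSpace 𝓘(ℝ, E) x}

/-- The endomorphism field `J` is skew-adjoint for the metric. This is what makes the fundamental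
form `ω = g(J ·, ·)` alternating. -/
def IsSkewAdjoint (J : Π x : M, TangentSpace 𝓘(ℝ, E) x →L[ℝ] TangentSpace 𝓘(ℝ, E) x) : Prop :=
  ∀ (x : M) (u v : TangentSpace 𝓘(ℝ, E) x), inner ℝ (J x u) v = -inner ℝ u (J x v)

theorem IsHermitian.isSkewAdjoint [IsManifold 𝓘(ℝ, E) ∞ M] (h : IsHermitian J) :
    IsSkewAdjoint J := fun x u v ↦ by
  rw [← h.inner_map_map x u (J x v), h.complex.sq, inner_neg_right, neg_neg]

theorem IsSkewAdjoint.fundForm_swap (hJ : IsSkewAdjoint J) (x : M)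
    (u v : TangentSpace 𝓘(ℝ, E) x) : fundForm J x u v = -fundForm J x v u := by
  rw [fundForm, fundForm, hJ, real_inner_comm]

theorem IsSkewAdjoint.JForm_eq_fundForm_sharp [FiniteDimensional ℝ E] (hJ : IsSkewAdjoint J)
    (θ : Π x : M, TangentSpace 𝓘(ℝ, E) x →L[ℝ] ℝ) (x : M) (u : TangentSpace 𝓘(ℝ, E) x) :
    JForm J θ x u = fundForm J x (sharp θ x) u := by
  rw [fundForm, hJ, inner_sharp_left]
  rfl

end SkewAdjoint

section ClosedForm

variable {E : Type*} [NormedAddCommGroup E] [NormedSpace ℝ E]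
  {M : Type*} [TopologicalSpace M] [ChartedSpace E M] [IsManifold 𝓘(ℝ, E) ∞ M]
  {J : Π x : M, TangentSpace 𝓘(ℝ, E) x →L[ℝ] TangentSpace 𝓘(ℝ, E) x}
  {θ : Π x : M, TangentSpace 𝓘(ℝ, E) x →L[ℝ] ℝ} {X Y : Π x : M, TangentSpace 𝓘(ℝ, E) x}

/-- The `1`-form `θ` is closed, tested on smooth vector fields as in `IsLCK`. -/
def IsClosedOneForm (θ : Π x : M, TangentSpace 𝓘(ℝ, E) x →L[ℝ] ℝ) : Prop :=
  ∀ X Y : Π x : M, TangentSpace 𝓘(ℝ, E) x, IsSmoothVF X → IsSmoothVF Y → ∀ x, dOne θ X Y x = 0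

variable [FiniteDimensional ℝ E] [RiemannianBundle (fun x : M ↦ TangentSpace 𝓘(ℝ, E) x)]

theorem IsClosedOneForm.lieDerivOne_sharp (hθ : IsClosedOneForm θ) (hT : IsSmoothVF (sharp θ))
    (hX : IsSmoothVF X) (x : M) :
    lieDerivOne (sharp θ) θ X x = dZero (normSq θ) x (X x) := by
  rw [lieDerivOne_eq_dOne_add_dZero, hθ _ _ hT hX, zero_add, normSq_eq_apply_sharp]

theorem IsClosedOneForm.JForm_dZero_normSq (hθ : IsClosedOneForm θ) (hJ : IsSmoothEnd J)
    (hT : IsHolomorphicVF J (sharp θ)) (hX : IsSmoothVF X) (x : M) :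
    JForm J (dZero (normSq θ)) x (X x) = lieDerivOne (sharp θ) (JForm J θ) X x := by
  rw [lieDerivOne_JForm θ (hT.2 X hX x), hθ.lieDerivOne_sharp hT.1 (hJ.apply hX)]
  rfl

variable [IsContMDiffRiemannianBundle 𝓘(ℝ, E) ∞ E (fun x : M ↦ TangentSpace 𝓘(ℝ, E) x)]

theorem IsSmoothVF.contMDiff_apply_of_sharp (hT : IsSmoothVF (sharp θ)) (hX : IsSmoothVF X) :
    ContMDiff 𝓘(ℝ, E) 𝓘(ℝ) ∞ (fun y ↦ θ y (X y)) := by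
  simpa only [inner_sharp_left] using hT.inner hX

theorem IsSmoothVF.contMDiff_JForm_of_sharp (hT : IsSmoothVF (sharp θ)) (hJ : IsSmoothEnd J)
    (hX : IsSmoothVF X) : ContMDiff 𝓘(ℝ, E) 𝓘(ℝ) ∞ (fun y ↦ JForm J θ y (X y)) :=
  (hT.contMDiff_apply_of_sharp (hJ.apply hX)).neg

theorem IsSmoothVF.contMDiff_normSq_of_sharp (hT : IsSmoothVF (sharp θ)) :
    ContMDiff 𝓘(ℝ, E) 𝓘(ℝ) ∞ (normSq θ) := by
  rw [normSq_eq_apply_sharp]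
  exact hT.contMDiff_apply_of_sharp hT

theorem IsSmoothVF.contMDiff_wedgeOneOne_JForm_of_sharp (hT : IsSmoothVF (sharp θ))
    (hJ : IsSmoothEnd J) (hX : IsSmoothVF X) (hY : IsSmoothVF Y) :
    ContMDiff 𝓘(ℝ, E) 𝓘(ℝ) ∞ (fun y ↦ wedgeOneOne θ (JForm J θ) y (X y) (Y y)) :=
  ((hT.contMDiff_apply_of_sharp hX).mul (hT.contMDiff_JForm_of_sharp hJ hY)).sub
    ((hT.contMDiff_apply_of_sharp hY).mul (hT.contMDiff_JForm_of_sharp hJ hX))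

theorem IsClosedOneForm.lieDerivTwo_wedgeOneOne_JForm (hθ : IsClosedOneForm θ)
    (hJ : IsSmoothEnd J) (hT : IsHolomorphicVF J (sharp θ))
    (hX : IsSmoothVF X) (hY : IsSmoothVF Y) (x : M) :
    lieDerivTwo (sharp θ) (wedgeOneOne θ (JForm J θ)) X Y x =
      wedgeOneOne (dZero (normSq θ)) (JForm J θ) x (X x) (Y x)
        + wedgeOneOne θ (JForm J (dZero (normSq θ))) x (X x) (Y x) := by
  have hdθ {Z} (hZ : IsSmoothVF Z) :=
    (hT.1.contMDiff_apply_of_sharp hZ).mdifferentiable (by simp) x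
  have hdJθ {Z} (hZ : IsSmoothVF Z) :=
    (hT.1.contMDiff_JForm_of_sharp hJ hZ).mdifferentiable (by simp) x
  rw [lieDerivTwo_wedgeOneOne _ (hdθ hX) (hdθ hY) (hdJθ hX) (hdJθ hY),
    hθ.lieDerivOne_sharp hT.1 hX, hθ.lieDerivOne_sharp hT.1 hY,
    ← hθ.JForm_dZero_normSq hJ hT hX, ← hθ.JForm_dZero_normSq hJ hT hY, wedgeOneOne, wedgeOneOne]

theorem IsClosedOneForm.inner_leviCivita_sharp_comm (hθ : IsClosedOneForm θ)
    (hT : IsSmoothVF (sharp θ)) (hX : IsSmoothVF X) (hY : IsSmoothVF Y) (x : M) :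
    inner ℝ (leviCivita (sharp θ) x (X x)) (Y x) =
      inner ℝ (X x) (leviCivita (sharp θ) x (Y x)) := by
  have hT' := hT.mdifferentiableAt x
  have hX' := hX.mdifferentiableAt x
  have hY' := hY.mdifferentiableAt x
  have hclosed := hθ X Y hX hY x
  simp only [dOne, ← inner_sharp_left, leviCivita_metric hX' hT' hY',
    leviCivita_metric hY' hT' hX', ← leviCivita_sub_leviCivita hX' hY', inner_sub_right]
    at hclosed
  rw [real_inner_comm (leviCivita (sharp θ) x (Y x))]
  linarith

theorem IsClosedOneForm.lieDerivTwo_inner_sharp (hθ : IsClosedOneForm θ)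
    (hT : IsSmoothVF (sharp θ)) (hX : IsSmoothVF X) (hY : IsSmoothVF Y) (x : M) :
    lieDerivTwo (sharp θ) (fun _ u v ↦ inner ℝ u v) X Y x =
      2 * inner ℝ (X x) (leviCivita (sharp θ) x (Y x)) := by
  rw [lieDerivTwo_inner (hT.mdifferentiableAt x) (hX.mdifferentiableAt x)
    (hY.mdifferentiableAt x), hθ.inner_leviCivita_sharp_comm hT hX hY, two_mul]

theorem IsClosedOneForm.lieDerivTwo_fundForm (hθ : IsClosedOneForm θ) (hJ : IsSmoothEnd J)
    (hskew : IsSkewAdjoint J) (hT : IsHolomorphicVF J (sharp θ))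
    (hX : IsSmoothVF X) (hY : IsSmoothVF Y) (x : M) :
    lieDerivTwo (sharp θ) (fundForm J) X Y x =
      2 * fundForm J x (leviCivita (sharp θ) x (X x)) (Y x) := by
  have hcomp : lieDerivTwo (sharp θ) (fundForm J) Y X x =
      lieDerivTwo (sharp θ) (fun _ u v ↦ inner ℝ u v) (fun y ↦ J y (Y y)) X x
        + inner ℝ (lieDerivEnd (sharp θ) J Y x) (X x) :=
    lieDerivTwo_comp (η := fun _ u v ↦ inner ℝ u v) (fun u v w ↦ by rw [inner_sub_left])
      (sharp θ) J Y X
  calc lieDerivTwo (sharp θ) (fundForm J) X Y x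
      = -lieDerivTwo (sharp θ) (fundForm J) Y X x := lieDerivTwo_swap hskew.fundForm_swap
    _ = -(2 * fundForm J x (Y x) (leviCivita (sharp θ) x (X x))) := by
      rw [hcomp, hT.2 Y hY, inner_zero_left, add_zero,
        hθ.lieDerivTwo_inner_sharp hT.1 (hJ.apply hY) hX, fundForm]
    _ = 2 * fundForm J x (leviCivita (sharp θ) x (X x)) (Y x) := by
      rw [hskew.fundForm_swap x (Y x)]
      ring

theorem IsClosedOneForm.lieDerivTwo_fundForm_comp
    {A : Π x : M, TangentSpace 𝓘(ℝ, E) x →L[ℝ] TangentSpace 𝓘(ℝ, E) x}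
    (hθ : IsClosedOneForm θ) (hJ : IsSmoothEnd J) (hskew : IsSkewAdjoint J)
    (hT : IsHolomorphicVF J (sharp θ)) (hAX : IsSmoothVF fun y ↦ A y (X y)) (hY : IsSmoothVF Y)
    (x : M) :
    lieDerivTwo (sharp θ) (fun y u v ↦ fundForm J y (A y u) v) X Y x =
      2 * fundForm J x (leviCivita (sharp θ) x (A x (X x))) (Y x)
        + fundForm J x (lieDerivEnd (sharp θ) A X x) (Y x) := by
  have hsub (u v w : TangentSpace 𝓘(ℝ, E) x) :
      fundForm J x (u - v) w = fundForm J x u w - fundForm J x v w := by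
    simp only [fundForm, map_sub, inner_sub_left]
  rw [lieDerivTwo_comp hsub, hθ.lieDerivTwo_fundForm hJ hskew hT hAX hY]

theorem IsClosedOneForm.dOne_JForm (hθ : IsClosedOneForm θ) (hJ : IsSmoothEnd J)
    (hskew : IsSkewAdjoint J) (hT : IsHolomorphicVF J (sharp θ))
    (hω : ∀ X Y Z : Π x : M, TangentSpace 𝓘(ℝ, E) x,
      IsSmoothVF X → IsSmoothVF Y → IsSmoothVF Z →
      ∀ x, dTwo (fundForm J) X Y Z x = wedgeOneTwo θ (fundForm J) x (X x) (Y x) (Z x))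
    (hX : IsSmoothVF X) (hY : IsSmoothVF Y) (x : M) :
    dOne (JForm J θ) X Y x = 2 * fundForm J x (leviCivita (sharp θ) x (X x)) (Y x)
      - normSq θ x * fundForm J x (X x) (Y x) + wedgeOneOne θ (JForm J θ) x (X x) (Y x) := by
  have cartan : lieDerivTwo (sharp θ) (fundForm J) X Y x =
      dTwo (fundForm J) (sharp θ) X Y x + dOne (JForm J θ) X Y x :=
    lieDerivTwo_eq_dTwo_add_dOne hskew.fundForm_swap
      (fun u v ↦ by rw [fundForm, map_neg, inner_neg_left, fundForm])
      (hskew.JForm_eq_fundForm_sharp θ) X Y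
  rw [hθ.lieDerivTwo_fundForm hJ hskew hT hX hY, hω _ _ _ hT.1 hX hY, wedgeOneTwo,
    hskew.fundForm_swap x (Y x) (sharp θ x), ← hskew.JForm_eq_fundForm_sharp,
    ← hskew.JForm_eq_fundForm_sharp] at cartan
  rw [normSq_eq_apply_sharp, wedgeOneOne]
  linarith

end ClosedForm

end LCK

open LCK in
theorem proposition4_general
    {E : Type*} [NormedAddCommGroup E] [NormedSpace ℝ E] [FiniteDimensional ℝ E]
    {M : Type*} [TopologicalSpace M] [ChartedSpace E M] [IsManifold 𝓘(ℝ, E) ∞ M]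
    [RiemannianBundle (fun x : M ↦ TangentSpace 𝓘(ℝ, E) x)]
    [IsContMDiffRiemannianBundle 𝓘(ℝ, E) ∞ E (fun x : M ↦ TangentSpace 𝓘(ℝ, E) x)]
    (J : Π x : M, TangentSpace 𝓘(ℝ, E) x →L[ℝ] TangentSpace 𝓘(ℝ, E) x)
    (hJ : IsSmoothEnd J) (hskew : IsSkewAdjoint J)
    (θ : Π x : M, TangentSpace 𝓘(ℝ, E) x →L[ℝ] ℝ) (hθ : IsClosedOneForm θ)
    (hω : ∀ X Y Z : Π x : M, TangentSpace 𝓘(ℝ, E) x,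
      IsSmoothVF X → IsSmoothVF Y → IsSmoothVF Z →
      ∀ x, dTwo (fundForm J) X Y Z x = wedgeOneTwo θ (fundForm J) x (X x) (Y x) (Z x))
    (T : Π x : M, TangentSpace 𝓘(ℝ, E) x) (hT : T = sharp θ) (hhol : IsHolomorphicVF J T)
    (F : Π x : M, TangentSpace 𝓘(ℝ, E) x →L[ℝ] TangentSpace 𝓘(ℝ, E) x) (hF : F = leviCivita T)
    (X Y : Π x : M, TangentSpace 𝓘(ℝ, E) x) (hX : IsSmoothVF X) (hY : IsSmoothVF Y) (x : M) :
    dOne (JForm J (dZero (normSq θ))) X Y x =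
      4 * fundForm J x (F x (F x (X x))) (Y x)
        + 2 * fundForm J x (lieDerivEnd T F X x) (Y x)
        - dirDeriv T (normSq θ) x * fundForm J x (X x) (Y x)
        - 2 * normSq θ x * fundForm J x (F x (X x)) (Y x)
        + wedgeOneOne (dZero (normSq θ)) (JForm J θ) x (X x) (Y x)
        + wedgeOneOne θ (JForm J (dZero (normSq θ))) x (X x) (Y x) := by
  have : CompleteSpace E := FiniteDimensional.complete ℝ E
  subst hT hF
  have hT := hhol.1
  have hFX := hX.leviCivita hT
  have hsq := hT.contMDiff_normSq_of_sharp.mdifferentiable (by simp) x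
  have hωXY := (hJ.contMDiff_fundForm hX hY).mdifferentiable (by simp) x
  have hωFXY := (hJ.contMDiff_fundForm hFX hY).mdifferentiable (by simp) x
  have h2ωFXY := (mdifferentiableAt_const (c := (2 : ℝ))).mul hωFXY
  have hwedge := (hT.contMDiff_wedgeOneOne_JForm_of_sharp hJ hX hY).mdifferentiable (by simp) x
  have dJd_eq_lieDeriv_dJ : dOne (JForm J (dZero (normSq θ))) X Y x =
      lieDerivTwo (sharp θ) (fun y u v ↦ 2 * fundForm J y (leviCivita (sharp θ) y u) v
        - normSq θ y * fundForm J y u v + wedgeOneOne θ (JForm J θ) y u v) X Y x :=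
    dOne_lieDerivOne (fun _ ↦ hT.contMDiff_JForm_of_sharp hJ)
      (fun _ ↦ hθ.JForm_dZero_normSq hJ hhol) (fun _ _ ↦ hθ.dOne_JForm hJ hskew hhol hω) hT hX hY x
  rw [dJd_eq_lieDeriv_dJ, lieDerivTwo_add _ (h2ωFXY.sub (hsq.mul hωXY)) hwedge,
    lieDerivTwo_sub _ h2ωFXY (hsq.mul hωXY),
    lieDerivTwo_const_mul (η := fun y u v ↦ fundForm J y (leviCivita (sharp θ) y u) v) _ _ hωFXY,
    lieDerivTwo_mul _ hsq hωXY, hθ.lieDerivTwo_fundForm_comp hJ hskew hhol hFX hY,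
    hθ.lieDerivTwo_fundForm hJ hskew hhol hX hY, hθ.lieDerivTwo_wedgeOneOne_JForm hJ hhol hX hY]
  ring

theorem proposition4
    {E : Type*} [NormedAddCommGroup E] [NormedSpace ℝ E] [FiniteDimensional ℝ E]
    {M : Type*} [TopologicalSpace M] [T2Space M] [ChartedSpace E M] [IsManifold 𝓘(ℝ, E) ∞ M]
    [RiemannianBundle (fun x : M ↦ TangentSpace 𝓘(ℝ, E) x)]
    [IsContMDiffRiemannianBundle 𝓘(ℝ, E) ∞ E (fun x : M ↦ TangentSpace 𝓘(ℝ, E) x)]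
    (J : Π x : M, TangentSpace 𝓘(ℝ, E) x →L[ℝ] TangentSpace 𝓘(ℝ, E) x)
    (θ : Π x : M, TangentSpace 𝓘(ℝ, E) x →L[ℝ] ℝ)
    (hlck : LCK.IsLCK J θ)
    (T : Π x : M, TangentSpace 𝓘(ℝ, E) x) (hT : T = LCK.sharp θ)
    (hhol : LCK.IsHolomorphicVF J T)
    (F : Π x : M, TangentSpace 𝓘(ℝ, E) x →L[ℝ] TangentSpace 𝓘(ℝ, E) x)
    (hF : F = LCK.leviCivita T)
    (X Y : Π x : M, TangentSpace 𝓘(ℝ, E) x) (hX : LCK.IsSmoothVF X) (hY : LCK.IsSmoothVF Y)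
    (x : M) :
    LCK.dOne (LCK.JForm J (LCK.dZero (LCK.normSq θ))) X Y x =
      4 * LCK.fundForm J x (F x (F x (X x))) (Y x)
        + 2 * LCK.fundForm J x (LCK.lieDerivEnd T F X x) (Y x)
        - LCK.dirDeriv T (LCK.normSq θ) x * LCK.fundForm J x (X x) (Y x)
        - 2 * LCK.normSq θ x * LCK.fundForm J x (F x (X x)) (Y x)
        + LCK.wedgeOneOne (LCK.dZero (LCK.normSq θ)) (LCK.JForm J θ) x (X x) (Y x)
        + LCK.wedgeOneOne θ (LCK.JForm J (LCK.dZero (LCK.normSq θ))) x (X x) (Y x) := by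
  exact proposition4_general J hlck.hermitian.complex.smooth hlck.hermitian.isSkewAdjoint θ
    hlck.closed hlck.d_fundForm T hT hhol F hF X Y hX hY x
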